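/- There exists $\theta\in\mathbb{R}$ such that the set $\mathsf{B}=\{B_0,B_1\}$ of real $6\times 6$ matrices defined by \[B_0:=\begin{pmatrix} 0&0&0&1&0&0\\ 0&0&0&0&1&0\\ 0&0&0&0&0&1\\ 1&0&0&0&0&0\\ 0&1&0&0&0&0\\ 0&0&1&0&0&0\end{pmatrix},\qquad B_1:=\begin{pmatrix} 1&0&0&0&0&0\\ 0&1&0&0&0&0\\ 0&0&0&0&0&0\\ 0&0&0&1&\sin\theta&\cos\theta-1\\ 0&0&0&0&\cos\theta&-\sin\theta\\ 0&0&0&0&\sin\theta&\cos\theta\end{pmatrix}\] has the following properties. For $n\ge 1$ let $\mathsf{B}_n$ be the set of all products of $n$ matrices from $\mathsf{B}$ (repetitions allowed). 1. The joint spectral radius of $\mathsf{B}$ equals $1$; that is, with $\|\cdot\|$ the Euclidean operator norm, \[\varrho(\mathsf{B}):=\lim_{n\to\infty}\max_{P\in\mathsf{B}_n}\|P\|^{1/n}=\inf_{n\ge 1}\max_{P\in\mathsf{B}_n}\|P\|^{1/n}=1 .\] 2. For every norm $|||\cdot|||$ on the vector space $M_6(\mathbb{R})$ of real $6\times 6$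 matrices (in particular for the Euclidean operator norm), the marginal instability rate sequence of $\mathsf{B}$ with respect to this norm, $b_n:=\max_{P\in\mathsf{B}_n}|||P|||$ for $n\ge1$, satisfies $b_n\simeq n^{1/3}$; that is, there is a constant $C>0$, possibly depending on the norm, such that \[C^{-1}n^{1/3}\le b_n\le C\,n^{1/3}\qquad\text{for all } n\ge 1 .\] -/

import Mathlib

namespace MarginalInstability

/-- The Euclidean operator norm of a real square matrix. -/
noncomputable def euclideanOpNorm {d : ℕ} (M : Matrix (Fin d) (Fin d) ℝ) : ℝ :=
  ‖Matrix.toEuclideanCLM (n := Fin d) (𝕜 := ℝ) M‖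

/-- The set `𝖠ₙ` of all products `A₁ ⋯ Aₙ` of length `n` with every factor in `𝖠`. -/
def products {d : ℕ} (A : Set (Matrix (Fin d) (Fin d) ℝ)) (n : ℕ) :
    Set (Matrix (Fin d) (Fin d) ℝ) :=
  {P | ∃ f : Fin n → Matrix (Fin d) (Fin d) ℝ, (∀ i, f i ∈ A) ∧ P = (List.ofFn f).prod}

/-- The `n`-th root of the largest Euclidean operator norm of a product of length `n`. -/
noncomputable def rootMaxNorm {d : ℕ} (A : Set (Matrix (Fin d) (Fin d) ℝ)) (n : ℕ) : ℝ :=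
  (sSup (euclideanOpNorm '' products A n)) ^ (1 / (n : ℝ))

/-- `A` is a bounded nonempty set of matrices whose joint spectral radius
`lim_{n → ∞} max {‖P‖ ^ (1/n) : P ∈ 𝖠ₙ} = inf_{n ≥ 1} max {‖P‖ ^ (1/n) : P ∈ 𝖠ₙ}`
exists and is equal to `ρ`. -/
structure HasJointSpectralRadius {d : ℕ} (A : Set (Matrix (Fin d) (Fin d) ℝ)) (ρ : ℝ) :
    Prop where
  nonempty : A.Nonempty
  bounded : ∃ C : ℝ, ∀ M ∈ A, euclideanOpNorm M ≤ C
  tendsto : Filter.Tendsto (rootMaxNorm A) Filter.atTop (nhds ρ)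
  isGLB : IsGLB {x : ℝ | ∃ n : ℕ, 1 ≤ n ∧ x = rootMaxNorm A n} ρ

/-- A norm on the vector space of real `d × d` matrices (not necessarily submultiplicative):
a seminorm that vanishes only at zero. -/
def IsNorm {d : ℕ} (N : Seminorm ℝ (Matrix (Fin d) (Fin d) ℝ)) : Prop :=
  ∀ M, N M = 0 → M = 0

/-- `(aₙ)_{n ≥ 1}` is the marginal instability rate sequence of `A` with respect to the
norm `N`: the joint spectral radius of `A` is `1` and `aₙ = max {N P : P ∈ 𝖠ₙ}` for every
`n ≥ 1`. The value `a 0` is irrelevant. -/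
def IsMarginalInstabilityRateSequence {d : ℕ} (N : Seminorm ℝ (Matrix (Fin d) (Fin d) ℝ))
    (A : Set (Matrix (Fin d) (Fin d) ℝ)) (a : ℕ → ℝ) : Prop :=
  HasJointSpectralRadius A 1 ∧ ∀ n : ℕ, 1 ≤ n → IsGreatest (N '' products A n) (a n)

/-- `aₙ ≲ bₙ`: there is `C > 0` such that `aₙ ≤ C bₙ` for all `n ≥ 1`. -/
def SeqLE (a b : ℕ → ℝ) : Prop :=
  ∃ C : ℝ, 0 < C ∧ ∀ n : ℕ, 1 ≤ n → a n ≤ C * b n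

/-- `aₙ ≃ bₙ`: both `aₙ ≲ bₙ` and `bₙ ≲ aₙ`. -/
def SeqSimilar (a b : ℕ → ℝ) : Prop :=
  SeqLE a b ∧ SeqLE b a

/-- The `6 × 6` matrix exchanging the two blocks of three coordinates. -/
def B₀ : Matrix (Fin 6) (Fin 6) ℝ :=
  !![0, 0, 0, 1, 0, 0;
     0, 0, 0, 0, 1, 0;
     0, 0, 0, 0, 0, 1;
     1, 0, 0, 0, 0, 0;
     0, 1, 0, 0, 0, 0;
     0, 0, 1, 0, 0, 0]

/-- The block diagonal sum of `diag(1, 1, 0)` and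
`[[1, sin θ, cos θ - 1], [0, cos θ, -sin θ], [0, sin θ, cos θ]]`. -/
noncomputable def B₁ (θ : ℝ) : Matrix (Fin 6) (Fin 6) ℝ :=
  !![1, 0, 0, 0, 0, 0;
     0, 1, 0, 0, 0, 0;
     0, 0, 0, 0, 0, 0;
     0, 0, 0, 1, Real.sin θ, Real.cos θ - 1;
     0, 0, 0, 0, Real.cos θ, -Real.sin θ;
     0, 0, 0, 0, Real.sin θ, Real.cos θ]

end MarginalInstability

namespace MarginalInstability

open Real Filter Topology

/-! Take θ = 2πφ, with φ the golden ratio. Each row of a product is supported in one block of three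
coordinates `(a, x, y)`. `B₀` swaps the blocks; `B₁` sets `y` to zero in the left block and, for `a
= 1`, rotates `(x, y + 1)` in the right block. So `m` rotations followed by a projection send `x` to
`sin (mθ) + x cos (mθ)`, and `x²` grows by at most 1. Growth forces `|x sin (mθ)| ≤ 2`. As φ is
badly approximable, this costs `m ≥ |x| / 8` steps, so `|x|³` grows at most linearly in time
(`abs_sin_add_mul_cos_pow_three_le`). Conversely, Fibonacci multipliers of order `x` increase `x²`
by a fixed amount (`exists_growth_step`), so the cube root is attained. -/

/-! ### Bad approximability of φ and the cost of growth -/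

theorem one_div_le_abs_mul_goldenRatio_sub {N : ℕ} (hN : 1 ≤ N) (p : ℤ) :
    1 / (4 * (N : ℝ)) ≤ |N * goldenRatio - p| := by
  by_contra! h
  have hN' : (1 : ℝ) ≤ N := by exact_mod_cast hN
  have hbound : |N * goldenRatio - p| * |N * goldenConj - p| < 1 := by
    have h1 : 1 / (4 * (N : ℝ)) ≤ 1 := by
      rw [div_le_one (by positivity)]; linarith
    have h2 : |N * goldenConj - p| ≤ 4 * N := by
      have h3 := abs_lt.1 h
      have h4 := goldenRatio_lt_two
      have h5 := neg_one_lt_goldenConj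
      have h6 := goldenConj_neg
      have h7 := goldenRatio_pos
      rw [abs_le]
      constructor <;> nlinarith
    calc |N * goldenRatio - p| * |N * goldenConj - p|
        ≤ |N * goldenRatio - p| * (4 * N) := by gcongr
      _ < 1 / (4 * (N : ℝ)) * (4 * N) := by gcongr
      _ = 1 := by field_simp
  -- The norm form of ℤ[φ] takes integer values, so one of absolute value below 1 vanishes,
  -- contradicting irrationality.
  have hprod : (N * goldenRatio - p) * (N * goldenConj - p) =
      ((p ^ 2 - N * p - N ^ 2 : ℤ) : ℝ) := by
    push_cast
    linear_combination (N : ℝ) ^ 2 * goldenRatio_mul_goldenConj -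
      (N : ℝ) * p * goldenRatio_add_goldenConj
  rw [← abs_mul, hprod, ← Int.cast_abs] at hbound
  have hzero : (p ^ 2 - N * p - N ^ 2 : ℤ) = 0 := Int.abs_lt_one_iff.1 (by exact_mod_cast hbound)
  rw [hzero, Int.cast_zero, mul_eq_zero] at hprod
  rcases hprod with h | h
  · exact ((goldenRatio_irrational.natCast_mul (by omega : N ≠ 0)).sub_intCast p).ne_zero h
  · exact ((goldenConj_irrational.natCast_mul (by omega : N ≠ 0)).sub_intCast p).ne_zero h

/-- The full angle times the golden ratio. -/
noncomputable def goldenAngle : ℝ := 2 * π * goldenRatio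

theorem one_div_le_abs_sin_mul_goldenAngle {m : ℕ} (hm : 1 ≤ m) :
    1 / (4 * (m : ℝ)) ≤ |sin (m * goldenAngle)| := by
  set p : ℤ := round ((2 * m : ℕ) * goldenRatio)
  set e : ℝ := (2 * m : ℕ) * goldenRatio - p with he
  have h1 : |e| ≤ 1 / 2 := abs_sub_round _
  have h2 := one_div_le_abs_mul_goldenRatio_sub (N := 2 * m) (by omega) p
  have h3 : m * goldenAngle = π * e + p * π := by
    rw [he, goldenAngle]; push_cast; ring
  have h4 : 2 / π * |π * e| ≤ |sin (π * e)| := mul_abs_le_abs_sin (by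
    rw [abs_mul, abs_of_pos pi_pos]; nlinarith [pi_pos])
  rw [h3, sin_add_int_mul_pi, abs_mul, abs_neg_one_zpow, one_mul]
  refine le_trans ?_ h4
  rw [abs_mul, abs_of_pos pi_pos]
  have h5 : 2 / π * (π * |e|) = 2 * |e| := by field_simp
  rw [h5]
  have h6 : 1 / (4 * (m : ℝ)) = 2 * (1 / (4 * ((2 * m : ℕ) : ℝ))) := by
    push_cast; field_simp
  rw [h6]
  linarith

/-- Rotation preserves the length of `(x, 1)`; the subtracted square is that of the other
coordinate. -/
theorem sin_add_mul_cos_sq (x α : ℝ) :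
    (sin α + x * cos α) ^ 2 = x ^ 2 + 1 - (cos α - x * sin α) ^ 2 := by
  linear_combination (1 + x ^ 2) * sin_sq_add_cos_sq α

theorem cube_sub_cube_le {a b : ℝ} (ha : 0 ≤ a) (hab : a < b) (h : b ^ 2 ≤ a ^ 2 + 1) :
    b ^ 3 ≤ a ^ 3 + (2 * a + 1) := by
  have h1 : b ≤ a + 1 := by nlinarith
  have h2 : b ^ 3 - a ^ 3 ≤ (b ^ 2 - a ^ 2) * (b + a) := by
    nlinarith [mul_nonneg ha (sub_pos.2 hab).le, mul_nonneg (mul_nonneg ha (sub_pos.2 hab).le)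
      (ha.trans hab.le)]
  nlinarith [mul_nonneg (sub_nonneg.2 h) (by linarith : 0 ≤ b + a)]

theorem abs_sin_add_mul_cos_pow_three_le (x : ℝ) (m : ℕ) :
    |sin (m * goldenAngle) + x * cos (m * goldenAngle)| ^ 3 ≤ |x| ^ 3 + 17 * m := by
  rcases Nat.eq_zero_or_pos m with rfl | hm
  · simp
  have hm' : (1 : ℝ) ≤ m := by exact_mod_cast hm
  set α := m * goldenAngle
  rcases le_or_gt |sin α + x * cos α| |x| with h | h
  · have := pow_le_pow_left₀ (abs_nonneg _) h 3
    linarith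
  have hsq := sin_add_mul_cos_sq x α
  have h1 : |cos α - x * sin α| < 1 := by
    rw [← sq_lt_one_iff_abs_lt_one]
    nlinarith [sq_lt_sq.2 h]
  have h2 : |x| * |sin α| ≤ 2 := by
    rw [← abs_mul, abs_le]
    have := abs_lt.1 h1
    constructor <;> linarith [cos_le_one α, neg_one_le_cos α]
  -- The cube grows by at most `2|x| + 1 ≤ 17m`.
  have h3 : |x| ≤ 8 * m := by
    have h4 := one_div_le_abs_sin_mul_goldenAngle hm
    have h5 : |x| * (1 / (4 * (m : ℝ))) ≤ 2 := le_trans (by gcongr) h2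
    rw [mul_one_div, div_le_iff₀ (by positivity)] at h5
    linarith
  have h6 := cube_sub_cube_le (abs_nonneg x) h
    (by rw [sq_abs, sq_abs]; nlinarith [sq_nonneg (cos α - x * sin α)])
  linarith

/-! ### Fibonacci return times and guaranteed growth -/

theorem fib_le_goldenRatio_pow (n : ℕ) : (Nat.fib n : ℝ) ≤ goldenRatio ^ n := by
  rcases n with _ | n
  · simp
  · rw [← goldenRatio_mul_fib_succ_add_fib]
    nlinarith [one_lt_goldenRatio, Nat.cast_nonneg (α := ℝ) (Nat.fib n),
      Nat.cast_nonneg (α := ℝ) (Nat.fib (n + 1))]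

/-- The odd index makes the offset positive, so that the rotation increases `x`. -/
theorem fib_mul_goldenAngle (k : ℕ) :
    Nat.fib (2 * k + 1) * goldenAngle =
      2 * π / goldenRatio ^ (2 * k + 1) + Nat.fib (2 * k + 2) * (2 * π) := by
  have h := fib_succ_sub_goldenRatio_mul_fib (2 * k + 1)
  have h1 : goldenConj ^ (2 * k + 1) = -(goldenRatio ^ (2 * k + 1))⁻¹ := by
    rw [← inv_pow, inv_goldenRatio, Odd.neg_pow ⟨k, rfl⟩, neg_neg]
  rw [h1] at h
  rw [goldenAngle, div_eq_mul_inv]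
  linear_combination -2 * π * h

/-- Some multiple of the golden angle lies, modulo the full angle, at distance comparable to
`1 / X` on the positive side of zero, with multiplier of order `X`. -/
theorem exists_nat_mul_goldenAngle {X : ℝ} (hX : 1 ≤ X) :
    ∃ (n : ℕ) (α : ℝ), (n : ℝ) ≤ 21 * X ∧ 3 / 10 ≤ α * X ∧ α * X ≤ 4 / 5 ∧
      sin (n * goldenAngle) = sin α ∧ cos (n * goldenAngle) = cos α := by
  have hφ : goldenRatio < 1.62 := by
    have := goldenRatio_sq; nlinarith [goldenRatio_pos]
  have hφ1 := one_lt_goldenRatio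
  have hpi := pi_gt_three
  have hpi' := pi_lt_d2
  -- This choice of `k` puts `P` between `5πX/2` and `20πX/3`, using `φ² < 8/3`; then `2πX / P` lies
  -- in `[3/10, 4/5]`.
  have hy : 1 ≤ 5 / 2 * π * goldenRatio * X := by
    have : 1 ≤ 5 / 2 * π := by linarith
    exact one_le_mul_of_one_le_of_one_le (one_le_mul_of_one_le_of_one_le this hφ1.le) hX
  obtain ⟨k, hk, hk'⟩ := exists_nat_pow_near hy
    (by nlinarith : 1 < goldenRatio ^ 2)
  set P := goldenRatio ^ (2 * k + 1) with hP
  have hPpos : 0 < P := by positivity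
  have hPlow : 5 / 2 * π * X ≤ P := by
    have : (goldenRatio ^ 2) ^ (k + 1) = P * goldenRatio := by
      rw [hP, ← pow_mul, ← pow_succ]; rfl
    rw [this] at hk'
    have := goldenRatio_pos
    nlinarith
  have hPup : P ≤ 20 / 3 * π * X := by
    have h1 : P = (goldenRatio ^ 2) ^ k * goldenRatio := by rw [hP, ← pow_mul, pow_succ]
    have h2 : P ≤ 5 / 2 * π * goldenRatio * X * goldenRatio := by rw [h1]; gcongr
    have h3 : 5 / 2 * π * goldenRatio * X * goldenRatio =
        5 / 2 * goldenRatio ^ 2 * (π * X) := by ring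
    have h4 : 5 / 2 * goldenRatio ^ 2 ≤ 20 / 3 := by rw [goldenRatio_sq]; linarith
    have h5 : 5 / 2 * goldenRatio ^ 2 * (π * X) ≤ 20 / 3 * (π * X) := by gcongr
    linarith
  refine ⟨Nat.fib (2 * k + 1), 2 * π / P, ?_, ?_, ?_, ?_, ?_⟩
  · refine (fib_le_goldenRatio_pow _).trans (hPup.trans ?_)
    nlinarith
  · rw [div_mul_eq_mul_div, le_div_iff₀ hPpos]; linarith
  · rw [div_mul_eq_mul_div, div_le_iff₀ hPpos]; linarith
  · rw [fib_mul_goldenAngle, sin_add_nat_mul_two_pi]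
  · rw [fib_mul_goldenAngle, cos_add_nat_mul_two_pi]

theorem exists_sq_add_le {x : ℝ} (hx : 0 ≤ x) :
    ∃ n : ℕ, (n : ℝ) ≤ 21 * (x + 1) ∧
      0 ≤ sin (n * goldenAngle) + x * cos (n * goldenAngle) ∧
      x ^ 2 + 1 / 400 ≤ (sin (n * goldenAngle) + x * cos (n * goldenAngle)) ^ 2 := by
  obtain ⟨n, α, hn, hα, hα', hs, hc⟩ := exists_nat_mul_goldenAngle (by linarith : 1 ≤ x + 1)
  have hpi := pi_gt_three
  have hpi' := pi_lt_d2
  have hα0 : 0 < α := by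
    by_contra! h
    nlinarith
  have hα1 : α ≤ 4 / 5 := by nlinarith
  have hsin : α / 2 ≤ sin α := by
    refine le_trans ?_ (mul_le_sin hα0.le (by linarith))
    rw [div_mul_eq_mul_div, le_div_iff₀ pi_pos]
    nlinarith
  have hsin' : sin α ≤ α := sin_le hα0.le
  have hcos : 0 ≤ cos α := cos_nonneg_of_neg_pi_div_two_le_of_le (by linarith) (by linarith)
  have hsc := sin_sq_add_cos_sq α
  refine ⟨n, hn, ?_, ?_⟩
  · rw [hs, hc]
    have : 0 ≤ x * cos α := by positivity
    linarith
  rw [hs, hc, sin_add_mul_cos_sq]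
  have hlow : -(4 / 5) ≤ cos α - x * sin α := by nlinarith
  -- The discarded coordinate stays away from 1: for `x ≥ 1` because of `x sin α`, for `x < 1`
  -- because `α` itself is not small.
  have hup : cos α - x * sin α ≤ 399 / 400 := by
    rcases le_or_gt 1 x with h | h
    · have : 15 / 100 ≤ α * x := by nlinarith
      nlinarith [cos_le_one α]
    · have h1 : 15 / 100 ≤ α := by nlinarith
      have h2 : 75 / 1000 ≤ sin α := by linarith
      have h3 : 0 ≤ x * sin α := mul_nonneg hx (by linarith)
      have h4 : cos α ≤ 399 / 400 := by nlinarith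
      linarith
  have := mul_nonneg (by linarith : 0 ≤ cos α - x * sin α + 399 / 400)
    (by linarith : 0 ≤ 399 / 400 - (cos α - x * sin α))
  nlinarith

/-- The potential `(x + 1)³` also handles small `x`. The `3` counts the two swaps and the projection
around `n` rotations: the cost is at most `24 (x + 1)`, while the potential gains at least `3 (x +
1) / 800`. -/
theorem exists_growth_step {x : ℝ} (hx : 0 ≤ x) :
    ∃ n : ℕ, (n : ℝ) ≤ 21 * (x + 1) ∧
      x ≤ sin (n * goldenAngle) + x * cos (n * goldenAngle) ∧
      (x + 1) ^ 3 + (n + 3) / 8000 ≤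
        (sin (n * goldenAngle) + x * cos (n * goldenAngle) + 1) ^ 3 := by
  obtain ⟨n, hn, h0, h1⟩ := exists_sq_add_le hx
  set z := sin (n * goldenAngle) + x * cos (n * goldenAngle) with hz
  have hzx : z ≤ x + 1 := by
    have := sin_le_one (n * goldenAngle)
    have := mul_le_mul_of_nonneg_left (cos_le_one (n * goldenAngle)) hx
    linarith
  have hxz : x ≤ z := by nlinarith
  refine ⟨n, hn, hxz, ?_⟩
  have h2 : 1 / 800 ≤ (z - x) * (x + 1) := by nlinarith
  have h3 : (x + 1) ^ 3 + 3 * ((z - x) * (x + 1)) * (x + 1) ≤ (z + 1) ^ 3 := by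
    have h4 : (z + 1) ^ 3 - ((x + 1) ^ 3 + 3 * ((z - x) * (x + 1)) * (x + 1)) =
      (z - x) ^ 2 * (3 * (x + 1) + (z - x)) := by ring
    have : 0 ≤ (z - x) ^ 2 * (3 * (x + 1) + (z - x)) :=
      mul_nonneg (sq_nonneg _) (by linarith)
    linarith
  have h5 := mul_le_mul_of_nonneg_right h2 (by linarith : 0 ≤ x + 1)
  linarith

/-! ### Products and the action of the generators on rows -/

section Products

variable {d : ℕ} {A : Set (Matrix (Fin d) (Fin d) ℝ)}

theorem products_zero : products A 0 = {1} := by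
  ext P
  simp [products]

theorem mem_products_succ {n : ℕ} {P : Matrix (Fin d) (Fin d) ℝ} :
    P ∈ products A (n + 1) ↔ ∃ Q ∈ products A n, ∃ M ∈ A, P = Q * M := by
  constructor
  · rintro ⟨f, hf, rfl⟩
    refine ⟨_, ⟨fun i => f i.castSucc, fun i => hf _, rfl⟩, f (Fin.last n), hf _, ?_⟩
    rw [List.ofFn_succ_last, List.prod_append, List.prod_singleton]
  · rintro ⟨_, ⟨f, hf, rfl⟩, M, hM, rfl⟩
    refine ⟨Fin.snoc f M, fun i => ?_, ?_⟩
    · refine Fin.lastCases ?_ (fun j => ?_) i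
      · simpa using hM
      · simpa using hf j
    · rw [List.ofFn_succ_last, List.prod_append, List.prod_singleton]
      simp

theorem mul_mem_products {n : ℕ} {P M : Matrix (Fin d) (Fin d) ℝ} (hP : P ∈ products A n)
    (hM : M ∈ A) : P * M ∈ products A (n + 1) :=
  mem_products_succ.2 ⟨P, hP, M, hM, rfl⟩

theorem finite_products (hA : A.Finite) (n : ℕ) : (products A n).Finite := by
  induction n with
  | zero => simp [products_zero]
  | succ n ih =>
    refine (ih.image2 (· * ·) hA).subset fun P hP => ?_
    obtain ⟨Q, hQ, M, hM, rfl⟩ := mem_products_succ.1 hP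
    exact ⟨Q, hQ, M, hM, rfl⟩

theorem pow_mem_products {M : Matrix (Fin d) (Fin d) ℝ} (hM : M ∈ A) (n : ℕ) :
    M ^ n ∈ products A n := by
  induction n with
  | zero => simp [products_zero]
  | succ n ih => rw [pow_succ]; exact mul_mem_products ih hM

end Products

section Rows

open Matrix

theorem vecMul_B₀ (v₀ v₁ v₂ v₃ v₄ v₅ : ℝ) :
    ![v₀, v₁, v₂, v₃, v₄, v₅] ᵥ* B₀ = ![v₃, v₄, v₅, v₀, v₁, v₂] := by
  ext i
  fin_cases i <;> simp [B₀, vecMul, dotProduct, Fin.sum_univ_succ]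

theorem vecMul_B₁_left (θ a x y : ℝ) :
    ![a, x, y, 0, 0, 0] ᵥ* B₁ θ = ![a, x, 0, 0, 0, 0] := by
  ext i
  fin_cases i <;> simp [B₁, vecMul, dotProduct, Fin.sum_univ_succ]

theorem vecMul_B₁_right (θ a x y : ℝ) :
    ![0, 0, 0, a, x, y] ᵥ* B₁ θ = ![0, 0, 0, a, a * sin θ + x * cos θ + y * sin θ,
      a * (cos θ - 1) - x * sin θ + y * cos θ] := by
  ext i
  fin_cases i <;> simp [B₁, vecMul, dotProduct, Fin.sum_univ_succ] <;> ring_nf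

end Rows

/-! ### Upper bound: an invariant for rows -/

section UpperBound

/-- The triples `(a, x, y)` that can occur as the nonzero block of a row of a product of length
at most `t` of the matrices `B₀` and `B₁ goldenAngle`: for `a = 0` the vector `(x, y)` stays in the
unit disc, and for `a = 1` the vector `(x, y + 1)` is a rotation of some `(z, 1)` with
`|z| ^ 3 = O(t)`. -/
def RowState (t : ℕ) (a x y : ℝ) : Prop :=
  (a = 0 ∧ x ^ 2 + y ^ 2 ≤ 1) ∨
  (a = 1 ∧ ∃ (z : ℝ) (s m : ℕ), s + m ≤ t ∧ |z| ^ 3 ≤ 17 * s ∧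
    x = sin (m * goldenAngle) + z * cos (m * goldenAngle) ∧
    y = cos (m * goldenAngle) - z * sin (m * goldenAngle) - 1)

theorem RowState.mono {t t' : ℕ} {a x y : ℝ} (h : RowState t a x y) (htt : t ≤ t') :
    RowState t' a x y := by
  rcases h with h | ⟨ha, z, s, m, hsm, h⟩
  · exact Or.inl h
  · exact Or.inr ⟨ha, z, s, m, hsm.trans htt, h⟩

theorem RowState.project {t : ℕ} {a x y : ℝ} (h : RowState t a x y) : RowState t a x 0 := by
  rcases h with ⟨ha, h⟩ | ⟨ha, z, s, m, hsm, hz, hx, -⟩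
  · exact Or.inl ⟨ha, by nlinarith [sq_nonneg y]⟩
  -- Projection restarts the rotation count at 0 with the current `x` as the new `z`; the `m`
  -- elapsed steps pay for the growth of `|z|³`.
  · refine Or.inr ⟨ha, x, s + m, 0, hsm, ?_, by simp, by simp⟩
    rw [hx]
    refine (abs_sin_add_mul_cos_pow_three_le z m).trans ?_
    push_cast
    linarith

theorem RowState.rotate {t : ℕ} {a x y : ℝ} (h : RowState t a x y) :
    RowState (t + 1) a (a * sin goldenAngle + x * cos goldenAngle + y * sin goldenAngle)
      (a * (cos goldenAngle - 1) - x * sin goldenAngle + y * cos goldenAngle) := by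
  rcases h with ⟨rfl, h⟩ | ⟨rfl, z, s, m, hsm, hz, hx, hy⟩
  · refine Or.inl ⟨rfl, le_trans (le_of_eq ?_) h⟩
    linear_combination (x ^ 2 + y ^ 2) * sin_sq_add_cos_sq goldenAngle
  · refine Or.inr ⟨rfl, z, s, m + 1, by omega, hz, ?_, ?_⟩
    · push_cast
      rw [add_mul, one_mul, sin_add, cos_add, hx, hy]
      ring_nf
    · push_cast
      rw [add_mul, one_mul, sin_add, cos_add, hx, hy]
      ring_nf

theorem RowState.abs_le {t : ℕ} (ht : 1 ≤ t) {a x y : ℝ} (h : RowState t a x y) :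
    |a| ≤ 5 * (t : ℝ) ^ (1 / 3 : ℝ) ∧ |x| ≤ 5 * (t : ℝ) ^ (1 / 3 : ℝ) ∧
      |y| ≤ 5 * (t : ℝ) ^ (1 / 3 : ℝ) := by
  have ht' : (1 : ℝ) ≤ t := by exact_mod_cast ht
  set r := (t : ℝ) ^ (1 / 3 : ℝ) with hr
  have hr1 : 1 ≤ r := one_le_rpow ht' (by norm_num)
  have hr3 : r ^ 3 = t := by
    rw [hr, ← rpow_natCast, ← rpow_mul (by linarith)]
    norm_num
  rcases h with ⟨rfl, h⟩ | ⟨rfl, z, s, m, hsm, hz, rfl, rfl⟩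
  · refine ⟨by simp; linarith, ?_, ?_⟩ <;> refine abs_le_of_sq_le_sq ?_ (by linarith) <;>
      nlinarith [sq_nonneg x, sq_nonneg y]
  · have hst : (s : ℝ) ≤ t := by exact_mod_cast (by omega : s ≤ t)
    have hz' : |z| ≤ 3 * r := by
      refine le_of_pow_le_pow_left₀ three_ne_zero (by linarith) ?_
      rw [mul_pow, hr3]
      linarith
    have hs := abs_sin_le_one (m * goldenAngle)
    have hc := abs_cos_le_one (m * goldenAngle)
    have h1 : |z * cos (m * goldenAngle)| ≤ |z| := by
      rw [abs_mul]; exact mul_le_of_le_one_right (abs_nonneg z) hc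
    have h2 : |z * sin (m * goldenAngle)| ≤ |z| := by
      rw [abs_mul]; exact mul_le_of_le_one_right (abs_nonneg z) hs
    rw [abs_one]
    refine ⟨by linarith, ?_, ?_⟩
    · have := abs_add_le (sin (m * goldenAngle)) (z * cos (m * goldenAngle))
      linarith
    · have h3 := abs_sub (cos (m * goldenAngle) - z * sin (m * goldenAngle)) 1
      have h4 := abs_sub (cos (m * goldenAngle)) (z * sin (m * goldenAngle))
      rw [abs_one] at h3
      linarith

theorem exists_rowState {n : ℕ} {P : Matrix (Fin 6) (Fin 6) ℝ}
    (hP : P ∈ products {B₀, B₁ goldenAngle} n) (i : Fin 6) :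
    ∃ a x y : ℝ, RowState n a x y ∧ (P i = ![a, x, y, 0, 0, 0] ∨ P i = ![0, 0, 0, a, x, y]) := by
  induction n generalizing P with
  | zero =>
    rw [products_zero, Set.mem_singleton_iff] at hP
    subst hP
    have h0 : RowState 0 1 0 0 := Or.inr ⟨rfl, 0, 0, 0, by simp, by simp, by simp, by simp⟩
    have h1 : RowState 0 0 1 0 := Or.inl ⟨rfl, by norm_num⟩
    have h2 : RowState 0 0 0 1 := Or.inl ⟨rfl, by norm_num⟩
    fin_cases i
    · exact ⟨1, 0, 0, h0, Or.inl (by ext j; fin_cases j <;> simp)⟩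
    · exact ⟨0, 1, 0, h1, Or.inl (by ext j; fin_cases j <;> simp)⟩
    · exact ⟨0, 0, 1, h2, Or.inl (by ext j; fin_cases j <;> simp)⟩
    · exact ⟨1, 0, 0, h0, Or.inr (by ext j; fin_cases j <;> simp)⟩
    · exact ⟨0, 1, 0, h1, Or.inr (by ext j; fin_cases j <;> simp)⟩
    · exact ⟨0, 0, 1, h2, Or.inr (by ext j; fin_cases j <;> simp)⟩
  | succ n ih =>
    obtain ⟨Q, hQ, M, hM, rfl⟩ := mem_products_succ.1 hP
    obtain ⟨a, x, y, h, hrow⟩ := ih hQ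
    rw [Matrix.mul_apply_eq_vecMul]
    rcases hM with rfl | hM
    · refine ⟨a, x, y, h.mono n.le_succ, hrow.symm.imp ?_ ?_⟩ <;> intro hi <;> rw [hi, vecMul_B₀]
    · rw [Set.mem_singleton_iff] at hM
      subst hM
      rcases hrow with hi | hi
      · exact ⟨a, x, 0, h.project.mono n.le_succ, Or.inl (by rw [hi, vecMul_B₁_left])⟩
      · exact ⟨_, _, _, h.rotate, Or.inr (by rw [hi, vecMul_B₁_right])⟩

theorem abs_apply_le {n : ℕ} (hn : 1 ≤ n) {P : Matrix (Fin 6) (Fin 6) ℝ}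
    (hP : P ∈ products {B₀, B₁ goldenAngle} n) (i j : Fin 6) :
    |P i j| ≤ 5 * (n : ℝ) ^ (1 / 3 : ℝ) := by
  obtain ⟨a, x, y, h, hrow⟩ := exists_rowState hP i
  obtain ⟨ha, hx, hy⟩ := h.abs_le hn
  have h0 : |(0 : ℝ)| ≤ 5 * (n : ℝ) ^ (1 / 3 : ℝ) := by rw [abs_zero]; positivity
  rcases hrow with hi | hi <;> rw [hi] <;> fin_cases j <;> assumption

end UpperBound

/-! ### Lower bound: greedy growth of the first row -/

section LowerBound

/-- Some product of length `t` of the matrices `B₀` and `B₁ goldenAngle` has the first row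
`(1, x, 0, 0, 0, 0)`. -/
def AttainsRow (t : ℕ) (x : ℝ) : Prop :=
  ∃ P ∈ products {B₀, B₁ goldenAngle} t, P 0 = ![1, x, 0, 0, 0, 0]

theorem attainsRow_one : AttainsRow 1 0 := by
  refine ⟨B₁ goldenAngle, ?_, ?_⟩
  · simpa using pow_mem_products (A := {B₀, B₁ goldenAngle}) (by simp : B₁ goldenAngle ∈ _) 1
  · ext j; fin_cases j <;> simp [B₁]

/-- Waiting is free: a row already projected is fixed by `B₁`, so every later length is available.
-/
theorem AttainsRow.add_one {t : ℕ} {x : ℝ} (h : AttainsRow t x) : AttainsRow (t + 1) x := by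
  obtain ⟨P, hP, hrow⟩ := h
  refine ⟨P * B₁ goldenAngle, mul_mem_products hP (by simp), ?_⟩
  rw [Matrix.mul_apply_eq_vecMul, hrow, vecMul_B₁_left]

theorem AttainsRow.mono {t t' : ℕ} {x : ℝ} (h : AttainsRow t x) (htt : t ≤ t') :
    AttainsRow t' x := by
  induction t', htt using Nat.le_induction with
  | base => exact h
  | succ n _ ih => exact ih.add_one

theorem exists_mem_products_rotate {t : ℕ} {x : ℝ} (h : AttainsRow t x) (m : ℕ) :
    ∃ P ∈ products {B₀, B₁ goldenAngle} (t + 1 + m), P 0 =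
      ![0, 0, 0, 1, sin (m * goldenAngle) + x * cos (m * goldenAngle),
        cos (m * goldenAngle) - x * sin (m * goldenAngle) - 1] := by
  induction m with
  | zero =>
    obtain ⟨P, hP, hrow⟩ := h
    refine ⟨P * B₀, mul_mem_products hP (by simp), ?_⟩
    rw [Matrix.mul_apply_eq_vecMul, hrow, vecMul_B₀]
    simp
  | succ m ih =>
    obtain ⟨P, hP, hrow⟩ := ih
    refine ⟨P * B₁ goldenAngle, mul_mem_products hP (by simp), ?_⟩
    rw [Matrix.mul_apply_eq_vecMul, hrow, vecMul_B₁_right]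
    have h : ((m + 1 : ℕ) : ℝ) * goldenAngle = m * goldenAngle + goldenAngle := by
      push_cast; ring
    have hx : ∀ s c s' c' : ℝ, 1 * s + (s' + x * c') * c + (c' - x * s' - 1) * s =
        s' * c + c' * s + x * (c' * c - s' * s) := by intros; ring
    have hy : ∀ s c s' c' : ℝ, 1 * (c - 1) - (s' + x * c') * s + (c' - x * s' - 1) * c =
        c' * c - s' * s - x * (s' * c + c' * s) - 1 := by intros; ring
    rw [h, sin_add, cos_add, hx, hy]

theorem AttainsRow.rotate {t : ℕ} {x : ℝ} (h : AttainsRow t x) (m : ℕ) :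
    AttainsRow (t + m + 3) (sin (m * goldenAngle) + x * cos (m * goldenAngle)) := by
  obtain ⟨P, hP, hrow⟩ := exists_mem_products_rotate h m
  refine ⟨P * B₀ * B₁ goldenAngle, ?_, ?_⟩
  · have := mul_mem_products (mul_mem_products hP (by simp : B₀ ∈ _))
      (by simp : B₁ goldenAngle ∈ _)
    rwa [show t + 1 + m + 1 + 1 = t + m + 3 by omega] at this
  · rw [Matrix.mul_apply_eq_vecMul, Matrix.mul_apply_eq_vecMul, hrow, vecMul_B₀, vecMul_B₁_left]

/-- Here `t` is the time of the last completed growth step before the horizon. The final inequality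
says that the remaining time does not exceed the cost bound `24 (x + 1)` of the next step; once it
fails, that step fits. -/
theorem exists_attainsRow (T : ℕ) : ∃ (t : ℕ) (x : ℝ), t ≤ T + 1 ∧ 0 ≤ x ∧ AttainsRow t x ∧
    (t : ℝ) / 8000 ≤ (x + 1) ^ 3 ∧ (T : ℝ) + 1 ≤ t + 24 * (x + 1) := by
  induction T with
  | zero => exact ⟨1, 0, le_rfl, le_rfl, attainsRow_one, by norm_num, by norm_num⟩
  | succ T ih =>
    obtain ⟨t, x, htT, hx, hrow, hcube, hgap⟩ := ih
    rcases le_or_gt (((T + 1 : ℕ) : ℝ) + 1) (t + 24 * (x + 1)) with h | h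
    · exact ⟨t, x, by omega, hx, hrow, hcube, h⟩
    obtain ⟨n, hn, hxz, hz⟩ := exists_growth_step hx
    refine ⟨t + n + 3, _, ?_, hx.trans hxz, hrow.rotate n, ?_, ?_⟩
    · have : ((t + n + 3 : ℕ) : ℝ) ≤ ((T + 1 + 1 : ℕ) : ℝ) := by
        push_cast at h ⊢; linarith
      exact_mod_cast this
    · push_cast; linarith
    · push_cast; linarith

theorem exists_apply_ge {n : ℕ} (hn : 1 ≤ n) :
    ∃ P ∈ products {B₀, B₁ goldenAngle} n, ∃ i j, (n : ℝ) ^ (1 / 3 : ℝ) / 80 ≤ |P i j| := by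
  obtain ⟨t, x, ht, hx, hrow, hcube, hgap⟩ := exists_attainsRow (n - 1)
  rw [Nat.sub_add_cancel hn] at ht
  rw [Nat.cast_sub hn, Nat.cast_one, sub_add_cancel] at hgap
  obtain ⟨P, hP, hP0⟩ := hrow.mono ht
  have hn' : (1 : ℝ) ≤ n := by exact_mod_cast hn
  set r := (n : ℝ) ^ (1 / 3 : ℝ) with hr
  have hr0 : 0 ≤ r := by positivity
  have hr3 : r ^ 3 = n := by
    rw [hr, ← rpow_natCast, ← rpow_mul (by linarith)]
    norm_num
  have hX : x + 1 ≤ (x + 1) ^ 3 := le_self_pow₀ (by linarith) three_ne_zero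
  -- `n ≤ t + 24 (x + 1) ≤ 8024 (x + 1)³ ≤ (40 (x + 1))³`.
  have hrx : r ≤ 40 * (x + 1) := by
    refine le_of_pow_le_pow_left₀ three_ne_zero (by linarith) ?_
    rw [mul_pow, hr3]
    linarith
  -- For small `x` one has `r ≤ 80`, and the entry 1 suffices.
  rcases le_total x 1 with h | h
  · refine ⟨P, hP, 0, 0, ?_⟩
    rw [hP0]
    simp
    linarith
  · refine ⟨P, hP, 0, 1, ?_⟩
    rw [hP0]
    simp
    rw [abs_of_nonneg hx]
    linarith

end LowerBound

/-! ### Comparison of an arbitrary norm with matrix entries -/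

section Norms

theorem exists_abs_le_mul_seminorm {E : Type*} [AddCommGroup E] [Module ℝ E]
    [FiniteDimensional ℝ E] (N : Seminorm ℝ E) (hN : ∀ x, N x = 0 → x = 0) (f : E →ₗ[ℝ] ℝ) :
    ∃ C : ℝ, 0 < C ∧ ∀ x, |f x| ≤ C * N x := by
  let _ : Norm E := ⟨N⟩
  have core : NormedSpace.Core ℝ E :=
    { norm_nonneg := fun x => apply_nonneg N x
      norm_smul := fun c x => map_smul_eq_mul N c x
      norm_triangle := fun x y => map_add_le_add N x y
      norm_eq_zero_iff := fun x => ⟨hN x, by rintro rfl; exact map_zero N⟩ }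
  let _ : NormedAddCommGroup E := NormedAddCommGroup.ofCore core
  let _ : NormedSpace ℝ E := NormedSpace.ofCore core
  refine ⟨‖LinearMap.toContinuousLinearMap f‖ + 1, by positivity, fun x => ?_⟩
  refine ((LinearMap.toContinuousLinearMap f).le_opNorm x).trans ?_
  exact mul_le_mul_of_nonneg_right (by linarith) (norm_nonneg x)

variable {d : ℕ}

theorem exists_seminorm_le (N : Seminorm ℝ (Matrix (Fin d) (Fin d) ℝ)) :
    ∃ C : ℝ, 0 < C ∧ ∀ (M : Matrix (Fin d) (Fin d) ℝ) (r : ℝ), 0 ≤ r →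
      (∀ i j, |M i j| ≤ r) → N M ≤ C * r := by
  have h0 : 0 ≤ ∑ i, ∑ j, N (Matrix.single i j 1) :=
    Finset.sum_nonneg fun i _ => Finset.sum_nonneg fun j _ => apply_nonneg N _
  refine ⟨1 + ∑ i, ∑ j, N (Matrix.single i j 1), by linarith, fun M r hr hM => ?_⟩
  have hsum (f : Fin d → Matrix (Fin d) (Fin d) ℝ) : N (∑ i, f i) ≤ ∑ i, N (f i) :=
    Finset.le_sum_of_subadditive N (map_zero N).le (map_add_le_add N) _ _
  calc N M = N (∑ i, ∑ j, Matrix.single i j (M i j)) := by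
        rw [← Matrix.matrix_eq_sum_single]
    _ ≤ ∑ i, ∑ j, N (Matrix.single i j (M i j)) :=
        (hsum _).trans (Finset.sum_le_sum fun i _ => hsum _)
    _ ≤ ∑ i, ∑ j, N (Matrix.single i j 1) * r := by
        refine Finset.sum_le_sum fun i _ => Finset.sum_le_sum fun j _ => ?_
        have : Matrix.single i j (M i j) = M i j • Matrix.single i j (1 : ℝ) := by
          rw [Matrix.smul_single, smul_eq_mul, mul_one]
        rw [this, map_smul_eq_mul, mul_comm, norm_eq_abs]
        exact mul_le_mul_of_nonneg_left (hM i j) (apply_nonneg N _)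
    _ ≤ (1 + ∑ i, ∑ j, N (Matrix.single i j 1)) * r := by
        simp_rw [← Finset.sum_mul]
        linarith

theorem exists_abs_apply_le {N : Seminorm ℝ (Matrix (Fin d) (Fin d) ℝ)} (hN : IsNorm N) :
    ∃ C : ℝ, 0 < C ∧ ∀ (M : Matrix (Fin d) (Fin d) ℝ) (i j), |M i j| ≤ C * N M := by
  choose C hC h using fun ij : Fin d × Fin d => exists_abs_le_mul_seminorm N hN
    (Matrix.entryLinearMap ℝ ℝ ij.1 ij.2)
  have h0 : 0 ≤ ∑ ij, C ij := Finset.sum_nonneg fun ij _ => (hC ij).le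
  refine ⟨1 + ∑ ij, C ij, by linarith, fun M i j => (h (i, j) M).trans ?_⟩
  refine mul_le_mul_of_nonneg_right ?_ (apply_nonneg N M)
  have := Finset.single_le_sum (f := C) (fun ij _ => (hC ij).le) (Finset.mem_univ (i, j))
  linarith

variable (d) in
/-- The Euclidean operator norm as a seminorm. -/
noncomputable def euclideanOpSeminorm : Seminorm ℝ (Matrix (Fin d) (Fin d) ℝ) :=
  (normSeminorm ℝ _).comp
    (Matrix.toEuclideanCLM (n := Fin d) (𝕜 := ℝ)).toAlgEquiv.toLinearMap

theorem euclideanOpNorm_mul_le (M M' : Matrix (Fin d) (Fin d) ℝ) :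
    euclideanOpNorm (M * M') ≤ euclideanOpNorm M * euclideanOpNorm M' := by
  simp only [euclideanOpNorm, map_mul]
  exact norm_mul_le _ _

theorem euclideanOpNorm_one [NeZero d] : euclideanOpNorm (1 : Matrix (Fin d) (Fin d) ℝ) = 1 := by
  simp [euclideanOpNorm]

/-- Powers of an involution square to the identity. Applied to `B₀`, this keeps the joint spectral
radius from dropping below 1. -/
theorem one_le_euclideanOpNorm_pow [NeZero d] {M : Matrix (Fin d) (Fin d) ℝ} (hM : M * M = 1)
    (n : ℕ) : 1 ≤ euclideanOpNorm (M ^ n) := by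
  have h : M ^ n * M ^ n = 1 := by rw [← pow_add, ← two_mul, pow_mul, pow_two, hM, one_pow]
  have h1 := euclideanOpNorm_mul_le (M ^ n) (M ^ n)
  rw [h, euclideanOpNorm_one] at h1
  have h2 : 0 ≤ euclideanOpNorm (M ^ n) := norm_nonneg _
  nlinarith

end Norms

/-! ### The joint spectral radius -/

theorem B₀_mul_B₀ : B₀ * B₀ = 1 := by
  ext i j
  fin_cases i <;> fin_cases j <;> simp [B₀, Matrix.mul_apply, Fin.sum_univ_succ]

theorem finite_pair (θ : ℝ) : ({B₀, B₁ θ} : Set (Matrix (Fin 6) (Fin 6) ℝ)).Finite :=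
  Set.toFinite _

theorem tendsto_mul_natCast_rpow_one_div {C : ℝ} (hC : 0 < C) :
    Tendsto (fun n : ℕ => (C * (n : ℝ)) ^ (1 / (n : ℝ))) atTop (𝓝 1) := by
  have h1 : Tendsto (fun n : ℕ => C ^ (1 / (n : ℝ))) atTop (𝓝 1) := by
    have := (continuousAt_const_rpow hC.ne' (b := 0)).tendsto.comp
      tendsto_one_div_atTop_nhds_zero_nat
    simpa [Function.comp_def] using this
  have h2 := h1.mul (tendsto_rpow_div.comp tendsto_natCast_atTop_atTop)
  rw [one_mul] at h2
  refine h2.congr fun n => ?_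
  rw [mul_rpow hC.le n.cast_nonneg]
  rfl

theorem one_le_rootMaxNorm (n : ℕ) : 1 ≤ rootMaxNorm {B₀, B₁ goldenAngle} n := by
  refine one_le_rpow ?_ (by positivity)
  exact le_csSup_of_le ((finite_products (finite_pair _) n).image _).bddAbove
    ⟨_, pow_mem_products (by simp) n, rfl⟩ (one_le_euclideanOpNorm_pow B₀_mul_B₀ n)

theorem tendsto_rootMaxNorm : Tendsto (rootMaxNorm {B₀, B₁ goldenAngle}) atTop (𝓝 1) := by
  obtain ⟨C, hC, h⟩ := exists_seminorm_le (euclideanOpSeminorm 6)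
  refine tendsto_of_tendsto_of_tendsto_of_le_of_le' tendsto_const_nhds
    (tendsto_mul_natCast_rpow_one_div (by positivity : 0 < C * 5))
    (Eventually.of_forall one_le_rootMaxNorm) ?_
  filter_upwards [eventually_ge_atTop 1] with n hn
  have hn' : (1 : ℝ) ≤ n := by exact_mod_cast hn
  refine rpow_le_rpow (Real.sSup_nonneg ?_) (csSup_le ?_ ?_) (by positivity)
  · rintro _ ⟨P, -, rfl⟩
    exact norm_nonneg _
  · exact ⟨_, _, pow_mem_products (M := B₀) (by simp) n, rfl⟩
  · rintro _ ⟨P, hP, rfl⟩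
    rw [mul_assoc]
    refine h P _ (by positivity) fun i j => (abs_apply_le hn hP i j).trans ?_
    gcongr
    -- The crude bound by `n` suffices, since `(Cn)^(1/n)` tends to 1.
    exact (rpow_le_rpow_of_exponent_le hn' (by norm_num)).trans_eq (rpow_one _)

theorem hasJointSpectralRadius_one : HasJointSpectralRadius {B₀, B₁ goldenAngle} 1 where
  nonempty := ⟨B₀, by simp⟩
  bounded := by
    obtain ⟨C, hC⟩ := ((finite_pair goldenAngle).image euclideanOpNorm).bddAbove
    exact ⟨C, fun M hM => hC ⟨M, hM, rfl⟩⟩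
  tendsto := tendsto_rootMaxNorm
  isGLB := by
    constructor
    · rintro _ ⟨n, -, rfl⟩
      exact one_le_rootMaxNorm n
    · intro b hb
      refine ge_of_tendsto tendsto_rootMaxNorm ?_
      filter_upwards [eventually_ge_atTop 1] with n hn
      exact hb ⟨n, hn, rfl⟩

end MarginalInstability

theorem mainTheorem1 :
    ∃ θ : ℝ,
      MarginalInstability.HasJointSpectralRadius
        {MarginalInstability.B₀, MarginalInstability.B₁ θ} 1 ∧
      ∀ N : Seminorm ℝ (Matrix (Fin 6) (Fin 6) ℝ), MarginalInstability.IsNorm N →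
        ∃ b : ℕ → ℝ,
          MarginalInstability.IsMarginalInstabilityRateSequence N
            {MarginalInstability.B₀, MarginalInstability.B₁ θ} b ∧
          MarginalInstability.SeqSimilar b (fun n => (n : ℝ) ^ (1 / 3 : ℝ)) := by
  open MarginalInstability in
  refine ⟨goldenAngle, hasJointSpectralRadius_one, fun N hN => ?_⟩
  have hmax (n : ℕ) : ∃ x, IsGreatest (N '' products {B₀, B₁ goldenAngle} n) x := by
    have hfin := (finite_products (finite_pair goldenAngle) n).image N
    have hne : (N '' products {B₀, B₁ goldenAngle} n).Nonempty :=
      ⟨_, _, pow_mem_products (M := B₀) (by simp) n, rfl⟩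
    exact ⟨_, hne.csSup_mem hfin, fun x hx => le_csSup hfin.bddAbove hx⟩
  choose b hb using hmax
  refine ⟨b, ⟨hasJointSpectralRadius_one, fun n _ => hb n⟩, ?_, ?_⟩
  · obtain ⟨C, hC, h⟩ := exists_seminorm_le N
    refine ⟨C * 5, by positivity, fun n hn => ?_⟩
    obtain ⟨P, hP, hPb⟩ := (hb n).1
    rw [← hPb, mul_assoc]
    exact h P _ (by positivity) (abs_apply_le hn hP)
  · obtain ⟨C, hC, h⟩ := exists_abs_apply_le hN
    refine ⟨80 * C, by positivity, fun n hn => ?_⟩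
    obtain ⟨P, hP, i, j, hij⟩ := exists_apply_ge hn
    have h1 := hij.trans (h P i j)
    have h2 := mul_le_mul_of_nonneg_left ((hb n).2 ⟨P, hP, rfl⟩) hC.le
    linarith
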